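/- Let $\alpha\in(1,2)$, let $\mu$ be the symmetric $\alpha$-stable probability distribution on $\mathbb R$ with characteristic function $e^{-|\lambda|^\alpha}$, and for $t>0$ let $p(t,\cdot)$ be the density with $\int_{\mathbb R}e^{i\lambda x}p(t,x)\,dx=e^{-t|\lambda|^\alpha}$, i.e. $p(t,x)=\frac1{2\pi}\int_{\mathbb R}e^{-i\lambda x}e^{-t|\lambda|^\alpha}\,d\lambda$. Let $h:\mathbb R\to\mathbb R$ be Lipschitz, write $\mu(h)=\int h\,d\mu$, and let $$f(x)=-\int_0^\infty\int_{-\infty}^\infty p\big(1-e^{-t},\,y-e^{-t/\alpha}x\big)\,\big(h(y)-\mu(h)\big)\,dy\,dt,\qquad x\in\mathbb R,$$ which is the Ornstein–Uhlenbeck semigroup representation of the solution of the stable Stein equation $\Delta^{\alpha/2}f(x)-\frac1\alpha x f'(x)=h(x)-\mu(h)$. Then $\mu(h)$ and $f$ are well defined (the integral $\mu(h)$, the inner integral for every $x$ and every $t>0$, and the outer integral for every $x$ converge absolutely), $f$ is twice differentiable on $\mathbb R$, and $$\|f'\|\le\alpha\,\|h'\|,\qquad \|f''\|\le\frac4\pi\sqrt{\frac{2\alpha+1}{\alpha}}\;\mathrm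 B\Big(\frac{\alpha-1}{\alpha},\frac2\alpha\Big)\,\|h'\|.$$ Here $\mathrm B(a,b)=\int_0^1u^{a-1}(1-u)^{b-1}\,du$, $\|\cdot\|$ is the uniform norm $\|g\|=\sup_x|g(x)|$, and in $\|h'\|$ the supremum is over the points where $h$ is differentiable. -/

import Mathlib

open MeasureTheory Set
open scoped NNReal ENNReal

noncomputable section

/-- The transition density `p(t, x)` of the standard symmetric `α`-stable process: the inverse
Fourier transform `(2π)⁻¹ ∫ exp (-i l x) exp (-t |l|^α) dl` of the characteristic function
`exp (-t |l|^α)`, for `t > 0`. That function is even in `l`, so the integral is the one with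
`cos (l x)` in place of `exp (-i l x)`. -/
def stableDensity (α t x : ℝ) : ℝ :=
  (2 * Real.pi)⁻¹ * ∫ l : ℝ, Real.cos (l * x) * Real.exp (-t * |l| ^ α)

/-- `μ` is the symmetric `α`-stable distribution with characteristic function
`exp (-|l|^α)`. -/
def IsStandardStable (α : ℝ) (μ : Measure ℝ) : Prop :=
  IsProbabilityMeasure μ ∧ ∀ l : ℝ, charFun μ l = (Real.exp (-|l| ^ α) : ℂ)

/-- The integrand `p(1 - e^{-t}, y - e^{-t/α} x) (h(y) - μ(h))` of the
Ornstein-Uhlenbeck semigroup representation. -/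
def steinIntegrand (α : ℝ) (μ : Measure ℝ) (h : ℝ → ℝ) (x t y : ℝ) : ℝ :=
  stableDensity α (1 - Real.exp (-t)) (y - Real.exp (-t / α) * x) * (h y - ∫ z, h z ∂μ)

/-- The solution `f` of the Stein equation `Δ^{α/2} f(x) - x f'(x) / α = h(x) - μ(h)` given by
the Ornstein-Uhlenbeck semigroup:
`f(x) = - ∫₀^∞ ∫ p(1 - e^{-t}, y - e^{-t/α} x) (h(y) - μ(h)) dy dt`. -/
def steinSolution (α : ℝ) (μ : Measure ℝ) (h : ℝ → ℝ) (x : ℝ) : ℝ :=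
  -∫ t in Ioi (0 : ℝ), ∫ y : ℝ, steinIntegrand α μ h x t y

/-- The uniform norm `sup_x |g x|`, with values in `[0, ∞]`. For `g = deriv h` with `h` Lipschitz,
the points where `h` is not differentiable (where `deriv h` is `0`) do not contribute. -/
def uniformNorm (g : ℝ → ℝ) : ℝ≥0∞ := ⨆ x : ℝ, ‖g x‖ₑ

end

/-! Write `c = (1 - e^{-t})^{1/α}` and `b = e^{-t/α}`. By self-similarity of the density, the
substitution `y = c z + b x` turns the inner integral into `P_t h(x) - μ(h)`, where `P_t φ(x) = ∫
φ(c z + b x) dμ(z)` (Mehler's formula). Since `μ` has a first moment, this is `O(e^{-t} + b|x|)`, so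
the outer integral converges.

Differentiating under both integrals gives `f' = -∫ b P_t(h') dt`, and `∫ b dt = α` yields the first
estimate. As `h'` is merely bounded and measurable, the next derivative is moved onto the density `p
= p(1, ·)`: `(P_t φ)' = -(b/c) ∫ φ(c z + b x) p'(z) dz`. Hence `|f''|` is at most `‖h'‖ ‖p'‖_1 ∫
b²/c dt`, and `u = 1 - e^{-t}` turns the last integral into the Beta value.

The bound on `‖p'‖_1` (`integral_abs_stableDensityDeriv_le`) comes from `|p'| ≤ 1/(πα)` and `x² |p'|
≤ (2α+1)/π`, both read off from the sine transform representing `p'`. That `p` is nonnegative and is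
the density of `μ` is proved by Fourier inversion and uniqueness of characteristic functions
(`IsStandardStable.nonneg_and_eq_withDensity`). -/

/-! ### Integration by parts in trigonometric integrals. -/

open Filter Topology in
theorem integral_mul_cos_mul_eq {g g' : ℝ → ℝ} {a x : ℝ}
    (hg : ∀ l ∈ Ioi (0 : ℝ), HasDerivAt g (g' l) l)
    (hgi : IntegrableOn g (Ioi 0)) (hgi' : IntegrableOn g' (Ioi 0))
    (h0 : Tendsto g (𝓝[>] 0) (𝓝 a)) (hinf : Tendsto g atTop (𝓝 0)) :
    (∫ l in Ioi (0 : ℝ), Real.cos (l * x) * g l) * x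
      = -∫ l in Ioi (0 : ℝ), Real.sin (l * x) * g' l := by
  have hv : ∀ l ∈ Ioi (0 : ℝ), HasDerivAt (fun l => Real.sin (l * x)) (Real.cos (l * x) * x) l := by
    intro l _
    simpa using ((hasDerivAt_id l).mul_const x).sin
  have hs : Tendsto (fun l : ℝ => Real.sin (l * x)) (𝓝[>] 0) (𝓝 0) := by
    have : Continuous (fun l : ℝ => Real.sin (l * x)) := by fun_prop
    simpa using (this.tendsto 0).mono_left nhdsWithin_le_nhds
  have := integral_Ioi_mul_deriv_eq_deriv_mul (a := 0) (u := g) (u' := g')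
    (v := fun l => Real.sin (l * x)) (v' := fun l => Real.cos (l * x) * x) (a' := 0) (b' := 0)
    hg hv
    (by
      have : IntegrableOn (fun l => (Real.cos (l * x) * x) * g l) (Ioi 0) :=
        hgi.bdd_mul (c := |x|) (by fun_prop) (ae_of_all _ fun l => by
          rw [norm_mul]
          exact mul_le_of_le_one_left (norm_nonneg x) (Real.abs_cos_le_one _))
      exact this.congr (ae_of_all _ fun l => mul_comm _ _))
    (by
      have : IntegrableOn (fun l => Real.sin (l * x) * g' l) (Ioi 0) :=
        hgi'.bdd_mul (c := 1) (by fun_prop) (ae_of_all _ fun l => Real.abs_sin_le_one _)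
      exact this.congr (ae_of_all _ fun l => mul_comm _ _))
    (by simpa [Pi.mul_def] using h0.mul hs)
    (by
      refine squeeze_zero_norm (fun l => ?_) (by simpa using hinf.norm)
      rw [Pi.mul_apply, norm_mul]
      exact mul_le_of_le_one_right (norm_nonneg _) (Real.abs_sin_le_one _))
  rw [← integral_mul_const]
  calc _ = ∫ l in Ioi (0 : ℝ), g l * (Real.cos (l * x) * x) := by
        congr 1; ext l; ring
    _ = _ := by rw [this]; simp [mul_comm]

-- Here `g` must vanish at `0`, because the boundary factor `cos` does not; in the cosine version
-- `sin` vanishes there and any finite limit will do.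
open Filter Topology in
theorem integral_mul_sin_mul_eq {g g' : ℝ → ℝ} {x : ℝ}
    (hg : ∀ l ∈ Ioi (0 : ℝ), HasDerivAt g (g' l) l)
    (hgi : IntegrableOn g (Ioi 0)) (hgi' : IntegrableOn g' (Ioi 0))
    (h0 : Tendsto g (𝓝[>] 0) (𝓝 0)) (hinf : Tendsto g atTop (𝓝 0)) :
    (∫ l in Ioi (0 : ℝ), Real.sin (l * x) * g l) * x
      = ∫ l in Ioi (0 : ℝ), Real.cos (l * x) * g' l := by
  have hv : ∀ l ∈ Ioi (0 : ℝ),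
      HasDerivAt (fun l => Real.cos (l * x)) (-Real.sin (l * x) * x) l := by
    intro l _
    simpa using ((hasDerivAt_id l).mul_const x).cos
  have hs : Tendsto (fun l : ℝ => Real.cos (l * x)) (𝓝[>] 0) (𝓝 1) := by
    have : Continuous (fun l : ℝ => Real.cos (l * x)) := by fun_prop
    simpa using (this.tendsto 0).mono_left nhdsWithin_le_nhds
  have := integral_Ioi_mul_deriv_eq_deriv_mul (a := 0) (u := g) (u' := g')
    (v := fun l => Real.cos (l * x)) (v' := fun l => -Real.sin (l * x) * x) (a' := 0) (b' := 0)
    hg hv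
    (by
      have : IntegrableOn (fun l => (-Real.sin (l * x) * x) * g l) (Ioi 0) :=
        hgi.bdd_mul (c := |x|) (by fun_prop) (ae_of_all _ fun l => by
          rw [norm_mul, norm_neg]
          exact mul_le_of_le_one_left (norm_nonneg x) (Real.abs_sin_le_one _))
      exact this.congr (ae_of_all _ fun l => mul_comm _ _))
    (by
      have : IntegrableOn (fun l => Real.cos (l * x) * g' l) (Ioi 0) :=
        hgi'.bdd_mul (c := 1) (by fun_prop) (ae_of_all _ fun l => Real.abs_cos_le_one _)
      exact this.congr (ae_of_all _ fun l => mul_comm _ _))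
    (by simpa [Pi.mul_def] using h0.mul hs)
    (by
      refine squeeze_zero_norm (fun l => ?_) (by simpa using hinf.norm)
      rw [Pi.mul_apply, norm_mul]
      exact mul_le_of_le_one_right (norm_nonneg _) (Real.abs_cos_le_one _))
  rw [← integral_mul_const]
  calc _ = -∫ l in Ioi (0 : ℝ), g l * (-Real.sin (l * x) * x) := by
        rw [← integral_neg]; congr 1; ext l; ring
    _ = _ := by rw [this]; simp [mul_comm]

/-! ### Size and decay of the cosine and sine transforms of `l ^ s * exp (-l ^ α)`. -/

section Kernel

variable {α : ℝ}

theorem hasDerivAt_rpow_mul_exp_neg_rpow (s : ℝ) {l : ℝ} (hl : 0 < l) :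
    HasDerivAt (fun l : ℝ => l ^ s * Real.exp (-l ^ α))
      (s * (l ^ (s - 1) * Real.exp (-l ^ α))
        - α * (l ^ (s + α - 1) * Real.exp (-l ^ α))) l := by
  have h1 := Real.hasDerivAt_rpow_const (p := s) (Or.inl hl.ne')
  have h2 := (Real.hasDerivAt_rpow_const (p := α) (Or.inl hl.ne')).neg.exp
  refine (h1.mul h2).congr_deriv ?_
  rw [show s + α - 1 = s + (α - 1) by ring, Real.rpow_add hl]
  simp only [Pi.neg_apply]
  ring

theorem integrableOn_rpow_mul_exp (hα : 1 < α) {s : ℝ} (hs : -1 < s) :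
    IntegrableOn (fun l : ℝ => l ^ s * Real.exp (-l ^ α)) (Ioi 0) :=
  integrableOn_rpow_mul_exp_neg_rpow hs (by linarith)

open Filter Topology in
theorem tendsto_rpow_mul_exp_neg_rpow_atTop (hα : 1 < α) (s : ℝ) :
    Tendsto (fun l : ℝ => l ^ s * Real.exp (-l ^ α)) atTop (𝓝 0) := by
  have h1 := (tendsto_rpow_mul_exp_neg_mul_atTop_nhds_zero (s / α) 1 one_pos).comp
    (tendsto_rpow_atTop (show 0 < α by linarith))
  refine h1.congr' ?_
  filter_upwards [eventually_gt_atTop 0] with l hl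
  simp only [Function.comp]
  rw [← Real.rpow_mul hl.le, mul_div_cancel₀ _ (by linarith : α ≠ 0)]
  simp

open Filter Topology in
theorem tendsto_exp_neg_rpow_zero (hα : 1 < α) :
    Tendsto (fun l : ℝ => Real.exp (-l ^ α)) (𝓝[>] 0) (𝓝 1) := by
  have : Continuous (fun l : ℝ => Real.exp (-l ^ α)) :=
    Real.continuous_exp.comp (Real.continuous_rpow_const (by linarith)).neg
  have h := (this.tendsto 0).mono_left (nhdsWithin_le_nhds (s := Ioi 0))
  simpa [Real.zero_rpow (by linarith : α ≠ 0)] using h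

open Filter Topology in
theorem tendsto_rpow_mul_exp_neg_rpow_zero (hα : 1 < α) {s : ℝ} (hs : 0 < s) :
    Tendsto (fun l : ℝ => l ^ s * Real.exp (-l ^ α)) (𝓝[>] 0) (𝓝 0) := by
  have h := ((Real.continuous_rpow_const hs.le).tendsto 0).mono_left
    (nhdsWithin_le_nhds (s := Ioi 0))
  simpa [Real.zero_rpow hs.ne'] using h.mul (tendsto_exp_neg_rpow_zero hα)

/-- The cosine transform of `l ^ s * exp (-l ^ α)` on the half-line. -/
noncomputable def cosTransform (α s x : ℝ) : ℝ :=
  ∫ l in Ioi (0 : ℝ), Real.cos (l * x) * (l ^ s * Real.exp (-l ^ α))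

/-- The sine transform of `l ^ s * exp (-l ^ α)` on the half-line. -/
noncomputable def sinTransform (α s x : ℝ) : ℝ :=
  ∫ l in Ioi (0 : ℝ), Real.sin (l * x) * (l ^ s * Real.exp (-l ^ α))

theorem integrableOn_cos_mul_kernel (hα : 1 < α) {s : ℝ} (hs : -1 < s) (x : ℝ) :
    IntegrableOn (fun l : ℝ => Real.cos (l * x) * (l ^ s * Real.exp (-l ^ α))) (Ioi 0) :=
  (integrableOn_rpow_mul_exp hα hs).bdd_mul (c := 1) (by fun_prop)
    (ae_of_all _ fun l => Real.abs_cos_le_one _)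

theorem integrableOn_sin_mul_kernel (hα : 1 < α) {s : ℝ} (hs : -1 < s) (x : ℝ) :
    IntegrableOn (fun l : ℝ => Real.sin (l * x) * (l ^ s * Real.exp (-l ^ α))) (Ioi 0) :=
  (integrableOn_rpow_mul_exp hα hs).bdd_mul (c := 1) (by fun_prop)
    (ae_of_all _ fun l => Real.abs_sin_le_one _)

theorem abs_cosTransform_le (hα : 1 < α) {s : ℝ} (hs : -1 < s) (x : ℝ) :
    |cosTransform α s x| ≤ 1 / α * Real.Gamma ((s + 1) / α) := by
  rw [← integral_rpow_mul_exp_neg_rpow (by linarith) hs, cosTransform, ← Real.norm_eq_abs]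
  refine norm_integral_le_of_norm_le (integrableOn_rpow_mul_exp hα hs) ?_
  filter_upwards [ae_restrict_mem measurableSet_Ioi] with l hl
  have : 0 ≤ l ^ s * Real.exp (-l ^ α) :=
    mul_nonneg (Real.rpow_nonneg (le_of_lt hl) _) (Real.exp_pos _).le
  rw [norm_mul, Real.norm_of_nonneg this]
  exact mul_le_of_le_one_left this (Real.abs_cos_le_one _)

theorem abs_sinTransform_le (hα : 1 < α) {s : ℝ} (hs : -1 < s) (x : ℝ) :
    |sinTransform α s x| ≤ 1 / α * Real.Gamma ((s + 1) / α) := by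
  rw [← integral_rpow_mul_exp_neg_rpow (by linarith) hs, sinTransform, ← Real.norm_eq_abs]
  refine norm_integral_le_of_norm_le (integrableOn_rpow_mul_exp hα hs) ?_
  filter_upwards [ae_restrict_mem measurableSet_Ioi] with l hl
  have : 0 ≤ l ^ s * Real.exp (-l ^ α) :=
    mul_nonneg (Real.rpow_nonneg (le_of_lt hl) _) (Real.exp_pos _).le
  rw [norm_mul, Real.norm_of_nonneg this]
  exact mul_le_of_le_one_left this (Real.abs_sin_le_one _)

/-- One integration by parts trades a factor `x` for a shift of the exponent; iterating it gives
decay in `x`. Positivity of `s` kills the boundary term and keeps `l ^ (s - 1)` integrable at `0`.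
-/
theorem sinTransform_mul (hα : 1 < α) {s : ℝ} (hs : 0 < s) (x : ℝ) :
    sinTransform α s x * x
      = s * cosTransform α (s - 1) x - α * cosTransform α (s + α - 1) x := by
  rw [sinTransform, integral_mul_sin_mul_eq
    (fun l hl => hasDerivAt_rpow_mul_exp_neg_rpow s hl)
    (integrableOn_rpow_mul_exp hα (by linarith))
    (((integrableOn_rpow_mul_exp hα (by linarith)).const_mul _).sub
      ((integrableOn_rpow_mul_exp hα (by linarith)).const_mul _))
    (tendsto_rpow_mul_exp_neg_rpow_zero hα hs) (tendsto_rpow_mul_exp_neg_rpow_atTop hα s),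
    cosTransform, cosTransform, ← integral_const_mul, ← integral_const_mul, ← integral_sub
      ((integrableOn_cos_mul_kernel hα (by linarith) x).const_mul _)
      ((integrableOn_cos_mul_kernel hα (by linarith) x).const_mul _)]
  congr 1; ext l; ring

theorem cosTransform_mul (hα : 1 < α) {s : ℝ} (hs : 0 < s) (x : ℝ) :
    cosTransform α s x * x
      = α * sinTransform α (s + α - 1) x - s * sinTransform α (s - 1) x := by
  rw [cosTransform, integral_mul_cos_mul_eq
    (fun l hl => hasDerivAt_rpow_mul_exp_neg_rpow s hl)
    (integrableOn_rpow_mul_exp hα (by linarith))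
    (((integrableOn_rpow_mul_exp hα (by linarith)).const_mul _).sub
      ((integrableOn_rpow_mul_exp hα (by linarith)).const_mul _))
    (tendsto_rpow_mul_exp_neg_rpow_zero hα hs) (tendsto_rpow_mul_exp_neg_rpow_atTop hα s),
    sinTransform, sinTransform, ← integral_const_mul, ← integral_const_mul, ← integral_sub
      ((integrableOn_sin_mul_kernel hα (by linarith) x).const_mul _)
      ((integrableOn_sin_mul_kernel hα (by linarith) x).const_mul _), ← integral_neg]
  congr 1; ext l; ring

/-- For exponent `0` the term that would carry the non-integrable `l ^ (-1)` is absent, so the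
general recursion needs this separate endpoint. -/
theorem cosTransform_zero_mul (hα : 1 < α) (x : ℝ) :
    cosTransform α 0 x * x = α * sinTransform α (α - 1) x := by
  rw [cosTransform, integral_mul_cos_mul_eq (a := 1)
    (g' := fun l => -α * (l ^ (α - 1) * Real.exp (-l ^ α)))
    (fun l hl => (hasDerivAt_rpow_mul_exp_neg_rpow (α := α) 0 hl).congr_deriv (by simp))
    (integrableOn_rpow_mul_exp hα (by linarith))
    ((integrableOn_rpow_mul_exp hα (by linarith)).const_mul _)
    (by simpa using tendsto_exp_neg_rpow_zero hα) (tendsto_rpow_mul_exp_neg_rpow_atTop hα 0),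
    sinTransform, ← integral_const_mul, ← integral_neg]
  congr 1; ext l; ring

/-- Two integrations by parts; the second leaves `l ^ (α - 2)`, integrable at `0` because `1 < α`.
The quadratic decay makes the density integrable. -/
theorem abs_cosTransform_zero_mul_sq_le (hα : 1 < α) (x : ℝ) :
    |cosTransform α 0 x| * x ^ 2 ≤
      (α - 1) * Real.Gamma ((α - 1) / α) + α * Real.Gamma ((2 * α - 1) / α) := by
  have hα0 : 0 < α := by linarith
  have h1 := cosTransform_zero_mul hα x
  have h2 := sinTransform_mul hα (s := α - 1) (by linarith) x
  have h3 := abs_cosTransform_le hα (s := α - 1 - 1) (by linarith) x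
  have h4 := abs_cosTransform_le hα (s := α - 1 + α - 1) (by linarith) x
  have e : cosTransform α 0 x * x ^ 2 = α * ((α - 1) * cosTransform α (α - 1 - 1) x)
      - α * (α * cosTransform α (α - 1 + α - 1) x) := by
    rw [pow_two, ← mul_assoc, h1, mul_assoc, h2]; ring
  rw [← abs_of_nonneg (sq_nonneg x), ← abs_mul, e]
  refine (abs_sub _ _).trans ?_
  simp only [abs_mul, abs_of_pos hα0, abs_of_pos (sub_pos.2 hα)]
  have h3' := mul_le_mul_of_nonneg_left h3 (mul_nonneg hα0.le (sub_pos.2 hα).le)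
  have h4' := mul_le_mul_of_nonneg_left h4 (mul_nonneg hα0.le hα0.le)
  have e3 : α * (α - 1) * (1 / α * Real.Gamma ((α - 1 - 1 + 1) / α))
      = (α - 1) * Real.Gamma ((α - 1) / α) := by
    rw [show α - 1 - 1 + 1 = α - 1 by ring]; field_simp
  have e4 : α * α * (1 / α * Real.Gamma ((α - 1 + α - 1 + 1) / α))
      = α * Real.Gamma ((2 * α - 1) / α) := by
    rw [show α - 1 + α - 1 + 1 = 2 * α - 1 by ring]; field_simp
  linarith

/-- After two integrations by parts only the exponents `α - 1` and `2α - 1` remain. Their absolute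
integrals are `Γ(1)/α` and `Γ(2)/α`, both `1/α`, so the bound is `(α + α²)/α + α²/α`. -/
theorem abs_sinTransform_one_mul_sq_le (hα : 1 < α) (x : ℝ) :
    |sinTransform α 1 x| * x ^ 2 ≤ 2 * α + 1 := by
  have hα0 : 0 < α := by linarith
  have h1 := sinTransform_mul hα one_pos x
  have h2 := cosTransform_zero_mul hα x
  have h3 := cosTransform_mul hα hα0 x
  have h4 := abs_sinTransform_le hα (s := α - 1) (by linarith) x
  have h5 := abs_sinTransform_le hα (s := α + α - 1) (by linarith) x
  rw [show (α - 1 + 1) / α = 1 by field_simp; ring, Real.Gamma_one, mul_one] at h4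
  rw [show (α + α - 1 + 1) / α = 2 by field_simp; ring, Real.Gamma_two, mul_one] at h5
  have e : sinTransform α 1 x * x ^ 2 = (α + α ^ 2) * sinTransform α (α - 1) x
      - α ^ 2 * sinTransform α (α + α - 1) x := by
    rw [pow_two, ← mul_assoc, h1, sub_self, show 1 + α - 1 = α by ring]
    linear_combination h2 - α * h3
  rw [← abs_of_nonneg (sq_nonneg x), ← abs_mul, e]
  refine (abs_sub _ _).trans ?_
  rw [abs_mul, abs_mul, abs_of_pos (by positivity : 0 < α + α ^ 2),
    abs_of_pos (by positivity : 0 < α ^ 2)]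
  have h4' := mul_le_mul_of_nonneg_left h4 (by positivity : 0 ≤ α + α ^ 2)
  have h5' := mul_le_mul_of_nonneg_left h5 (by positivity : 0 ≤ α ^ 2)
  have e4 : (α + α ^ 2) * (1 / α) = 1 + α := by field_simp
  have e5 : α ^ 2 * (1 / α) = α := by field_simp
  linarith

theorem abs_sinTransform_one_le (hα : 1 < α) (hα₂ : α < 2) (x : ℝ) :
    |sinTransform α 1 x| ≤ 1 / α := by
  have hα0 : 0 < α := by linarith
  refine (abs_sinTransform_le hα (by norm_num) x).trans ?_
  refine mul_le_of_le_one_right (by positivity) ?_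
  have h1 : 1 ≤ 2 / α := by rw [le_div_iff₀ hα0]; linarith
  have h2 : 2 / α ≤ 2 := by rw [div_le_iff₀ hα0]; linarith
  -- `2/α` lies in `[1, 2]` and `Γ(1) = Γ(2) = 1`, so convexity gives `Γ(2/α) ≤ 1`.
  have := Real.convexOn_Gamma.2 (mem_Ioi.2 one_pos) (mem_Ioi.2 two_pos)
    (sub_nonneg.2 h2) (sub_nonneg.2 h1) (by ring)
  simp only [smul_eq_mul, Real.Gamma_one, Real.Gamma_two] at this
  rw [show (2 - 2 / α) * 1 + (2 / α - 1) * 2 = (1 + 1) / α by field_simp; ring] at this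
  linarith

theorem hasDerivAt_cosTransform_zero (hα : 1 < α) (x : ℝ) :
    HasDerivAt (cosTransform α 0) (-sinTransform α 1 x) x := by
  have hE : Measurable fun l : ℝ => Real.exp (-l ^ α) := by fun_prop
  have := (hasDerivAt_integral_of_dominated_loc_of_deriv_le (μ := volume.restrict (Ioi (0 : ℝ)))
    (F := fun x l => Real.cos (l * x) * (l ^ (0 : ℝ) * Real.exp (-l ^ α)))
    (F' := fun x l => -(Real.sin (l * x) * (l ^ (1 : ℝ) * Real.exp (-l ^ α))))
    (x₀ := x) (s := univ) (bound := fun l => l ^ (1 : ℝ) * Real.exp (-l ^ α)) Filter.univ_mem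
    (Filter.Eventually.of_forall fun y =>
      (integrableOn_cos_mul_kernel hα (by norm_num) y).aestronglyMeasurable)
    (integrableOn_cos_mul_kernel hα (by norm_num) x)
    (integrableOn_sin_mul_kernel hα (by norm_num) x).neg.aestronglyMeasurable
    (by
      filter_upwards [ae_restrict_mem measurableSet_Ioi] with l hl y _
      have : 0 ≤ l ^ (1 : ℝ) * Real.exp (-l ^ α) :=
        mul_nonneg (Real.rpow_nonneg (le_of_lt hl) _) (Real.exp_pos _).le
      rw [norm_neg, norm_mul, Real.norm_of_nonneg this]
      exact mul_le_of_le_one_left this (Real.abs_sin_le_one _))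
    (integrableOn_rpow_mul_exp hα (by norm_num))
    (ae_of_all _ fun l y _ => by
      have := ((Real.hasDerivAt_cos (l * y)).comp y ((hasDerivAt_id y).const_mul l)).mul_const
        (l ^ (0 : ℝ) * Real.exp (-l ^ α))
      refine this.congr_deriv ?_
      simp
      ring)).2
  rw [integral_neg] at this
  exact this

theorem measurable_sinTransform (s : ℝ) : Measurable (sinTransform α s) := by
  have : Measurable fun p : ℝ × ℝ =>
      Real.sin (p.2 * p.1) * (p.2 ^ s * Real.exp (-p.2 ^ α)) := by fun_prop
  exact this.stronglyMeasurable.integral_prod_right.measurable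

end Kernel

/-! ### The stable density: scaling, derivative, and identification with the law. -/

section Density

variable {α : ℝ}

theorem stableDensity_one_eq (α x : ℝ) :
    stableDensity α 1 x = Real.pi⁻¹ * cosTransform α 0 x := by
  have h := integral_comp_abs (f := fun l => Real.cos (l * x) * Real.exp (-l ^ α))
  have e : ∀ l : ℝ, Real.cos (l * x) * Real.exp (-1 * |l| ^ α)
      = Real.cos (|l| * x) * Real.exp (-|l| ^ α) := by
    intro l
    rcases abs_choice l with hl | hl <;> rw [neg_one_mul] <;> congr 1
    · rw [hl]
    · rw [hl, neg_mul, Real.cos_neg]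
  simp only [stableDensity, e, h, cosTransform, Real.rpow_zero, one_mul]
  rw [mul_inv]
  ring

theorem stableDensity_rpow (α : ℝ) {c : ℝ} (hc : 0 < c) (x : ℝ) :
    stableDensity α (c ^ α) x = c⁻¹ * stableDensity α 1 (x / c) := by
  have h := Measure.integral_comp_mul_left
    (fun l => Real.cos (l * (x / c)) * Real.exp (-1 * |l| ^ α)) c
  have e : ∀ l : ℝ, Real.cos (c * l * (x / c)) * Real.exp (-1 * |c * l| ^ α)
      = Real.cos (l * x) * Real.exp (-c ^ α * |l| ^ α) := by
    intro l
    rw [abs_mul, abs_of_pos hc, Real.mul_rpow hc.le (abs_nonneg l)]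
    congr 2
    · field_simp
    · ring
  simp only [e, smul_eq_mul, abs_of_pos (inv_pos.2 hc)] at h
  rw [stableDensity, h, stableDensity]
  ring

/-- The derivative of the stable density at time `1`. -/
noncomputable def stableDensityDeriv (α x : ℝ) : ℝ := -(Real.pi⁻¹ * sinTransform α 1 x)

theorem hasDerivAt_stableDensity (hα : 1 < α) (x : ℝ) :
    HasDerivAt (stableDensity α 1) (stableDensityDeriv α x) x := by
  have e : stableDensity α 1 = fun x => Real.pi⁻¹ * cosTransform α 0 x :=
    funext (stableDensity_one_eq α)
  rw [e]
  exact ((hasDerivAt_cosTransform_zero hα x).const_mul _).congr_deriv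
    (by rw [stableDensityDeriv]; ring)

theorem continuous_stableDensity (hα : 1 < α) : Continuous (stableDensity α 1) :=
  continuous_iff_continuousAt.2 fun x => (hasDerivAt_stableDensity hα x).continuousAt

theorem measurable_stableDensityDeriv (α : ℝ) : Measurable (stableDensityDeriv α) :=
  ((measurable_sinTransform 1).const_mul _).neg

theorem abs_stableDensityDeriv_le (hα : 1 < α) (hα₂ : α < 2) (x : ℝ) :
    |stableDensityDeriv α x| ≤ Real.pi⁻¹ * (1 / α) := by
  rw [stableDensityDeriv, abs_neg, abs_mul, abs_of_pos (inv_pos.2 Real.pi_pos)]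
  exact mul_le_mul_of_nonneg_left (abs_sinTransform_one_le hα hα₂ x)
    (inv_pos.2 Real.pi_pos).le

theorem abs_stableDensityDeriv_mul_sq_le (hα : 1 < α) (x : ℝ) :
    |stableDensityDeriv α x| * x ^ 2 ≤ Real.pi⁻¹ * (2 * α + 1) := by
  rw [stableDensityDeriv, abs_neg, abs_mul, abs_of_pos (inv_pos.2 Real.pi_pos), mul_assoc]
  exact mul_le_mul_of_nonneg_left (abs_sinTransform_one_mul_sq_le hα x)
    (inv_pos.2 Real.pi_pos).le

theorem exists_abs_stableDensity_le (hα : 1 < α) :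
    ∃ C, ∀ x, |stableDensity α 1 x| ≤ C * (1 + x ^ 2)⁻¹ := by
  refine ⟨Real.pi⁻¹ * (1 / α * Real.Gamma ((0 + 1) / α) +
    ((α - 1) * Real.Gamma ((α - 1) / α) + α * Real.Gamma ((2 * α - 1) / α))), fun x => ?_⟩
  rw [← div_eq_mul_inv, le_div_iff₀ (by positivity), stableDensity_one_eq, abs_mul,
    abs_of_pos (inv_pos.2 Real.pi_pos), mul_assoc]
  refine mul_le_mul_of_nonneg_left ?_ (inv_pos.2 Real.pi_pos).le
  rw [mul_add, mul_one]
  exact add_le_add (abs_cosTransform_le hα (by norm_num) x) (abs_cosTransform_zero_mul_sq_le hα x)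

theorem exists_abs_stableDensityDeriv_le (hα : 1 < α) (hα₂ : α < 2) :
    ∃ C, 0 ≤ C ∧ ∀ x, |stableDensityDeriv α x| ≤ C * (1 + x ^ 2)⁻¹ := by
  refine ⟨Real.pi⁻¹ * (1 / α) + Real.pi⁻¹ * (2 * α + 1), ?_, fun x => ?_⟩
  · have := Real.pi_pos; positivity
  rw [← div_eq_mul_inv, le_div_iff₀ (by positivity), mul_add, mul_one]
  exact add_le_add (abs_stableDensityDeriv_le hα hα₂ x) (abs_stableDensityDeriv_mul_sq_le hα x)

theorem integrable_stableDensity (hα : 1 < α) : Integrable (stableDensity α 1) := by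
  obtain ⟨C, hC⟩ := exists_abs_stableDensity_le hα
  exact (integrable_inv_one_add_sq.const_mul C).mono'
    (continuous_stableDensity hα).aestronglyMeasurable (ae_of_all _ hC)

theorem integrable_stableDensityDeriv (hα : 1 < α) (hα₂ : α < 2) :
    Integrable (stableDensityDeriv α) := by
  obtain ⟨C, -, hC⟩ := exists_abs_stableDensityDeriv_le hα hα₂
  exact (integrable_inv_one_add_sq.const_mul C).mono'
    (measurable_stableDensityDeriv α).aestronglyMeasurable (ae_of_all _ hC)

theorem MeasureTheory.IntegrableOn.integrable_comp_abs {f : ℝ → ℝ}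
    (hf : IntegrableOn f (Ioi 0)) : Integrable fun x => f |x| := by
  have h1 : IntegrableOn (fun x => f |x|) (Ioi 0) :=
    hf.congr_fun (fun x hx => by rw [abs_of_pos hx]) measurableSet_Ioi
  have h2 : IntegrableOn (fun x => f |x|) (Iic 0) := by
    have := (Measure.measurePreserving_neg (volume : Measure ℝ)).integrableOn_comp_preimage
      measurableEmbedding_neg (f := fun x => f |x|) (s := Ici 0)
    simpa [Function.comp_def] using this.2 ((integrableOn_Ici_iff_integrableOn_Ioi (by simp)).2 h1)
  rw [← integrableOn_univ, ← Iic_union_Ioi (a := (0 : ℝ))]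
  exact h2.union h1

/-- Use the constant bound for `|x| ≤ r` and the inverse-square bound beyond; the factor `2` counts
the two half-lines. -/
theorem integral_le_of_le_of_mul_sq_le {g : ℝ → ℝ} {A B r : ℝ} (hr : 0 < r)
    (hg : Integrable g) (hA : ∀ x, g x ≤ A) (hB : ∀ x, g x * x ^ 2 ≤ B) :
    ∫ x, g x ≤ 2 * (A * r + B / r) := by
  let G : ℝ → ℝ := fun u => if u ≤ r then A else B * u ^ (-2 : ℝ)
  have h1 : IntegrableOn G (Ioc 0 r) := by
    refine (integrableOn_const (C := A) (by simp)).congr_fun (fun u hu => ?_) measurableSet_Ioc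
    simp [G, hu.2]
  have h2' : IntegrableOn (fun u => B * u ^ (-2 : ℝ)) (Ioi r) :=
    (integrableOn_Ioi_rpow_of_lt (by norm_num) hr).const_mul B
  have h2 : IntegrableOn G (Ioi r) := by
    refine h2'.congr_fun (fun u hu => ?_) measurableSet_Ioi
    simp [G, not_le.2 (mem_Ioi.1 hu)]
  have h12 : IntegrableOn G (Ioi 0) := by
    rw [← Ioc_union_Ioi_eq_Ioi hr.le]; exact h1.union h2
  have hle : ∀ x, g x ≤ G |x| := by
    intro x
    by_cases hx : |x| ≤ r
    · simpa [G, hx] using hA x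
    · have hx0 : 0 < |x| := hr.trans (not_le.1 hx)
      have : 0 < x ^ 2 := by rw [← sq_abs]; positivity
      simp only [G, hx, if_false]
      rw [Real.rpow_neg hx0.le, Real.rpow_two, sq_abs, ← div_eq_mul_inv, le_div_iff₀ this]
      exact hB x
  calc ∫ x, g x ≤ ∫ x, G |x| := integral_mono hg (h12.integrable_comp_abs) hle
    _ = 2 * ∫ u in Ioi 0, G u := integral_comp_abs
    _ = 2 * ((∫ u in Ioc 0 r, G u) + ∫ u in Ioi r, G u) := by
      rw [← Ioc_union_Ioi_eq_Ioi hr.le,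
        setIntegral_union (Ioc_disjoint_Ioi le_rfl) measurableSet_Ioi h1 h2]
    _ = 2 * ((∫ u in Ioc 0 r, A) + ∫ u in Ioi r, B * u ^ (-2 : ℝ)) := by
      congr 2
      · refine setIntegral_congr_fun measurableSet_Ioc fun u hu => ?_
        simp [G, hu.2]
      · refine setIntegral_congr_fun measurableSet_Ioi fun u hu => ?_
        simp [G, not_le.2 (mem_Ioi.1 hu)]
    _ = 2 * (A * r + B / r) := by
      rw [integral_const_mul, integral_Ioi_rpow_of_lt (by norm_num) hr]
      norm_num [hr.le, Real.rpow_neg_one]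
      ring

theorem integral_abs_stableDensityDeriv_le (hα : 1 < α) (hα₂ : α < 2) :
    ∫ x, |stableDensityDeriv α x| ≤ 4 / Real.pi * Real.sqrt ((2 * α + 1) / α) := by
  have hα0 : 0 < α := by linarith
  set q := Real.sqrt ((2 * α + 1) / α) with hq
  have hq0 : 0 < q := Real.sqrt_pos.2 (by positivity)
  have hq2 : q * q = (2 * α + 1) / α := Real.mul_self_sqrt (by positivity)
  -- The cut `r = α q` equals `sqrt (B / A)`, the minimiser of `A r + B / r`, with `A = 1/(πα)` and
  -- `B = (2α+1)/π`.
  refine (integral_le_of_le_of_mul_sq_le (mul_pos hα0 hq0)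
    (integrable_stableDensityDeriv hα hα₂).abs (abs_stableDensityDeriv_le hα hα₂)
    (abs_stableDensityDeriv_mul_sq_le hα)).trans_eq ?_
  have : 2 * α + 1 = q * q * α := by rw [hq2]; field_simp
  rw [this]
  have := Real.pi_pos
  field_simp
  ring

theorem integrable_exp_neg_abs_rpow (hα : 1 < α) :
    Integrable fun l : ℝ => Real.exp (-|l| ^ α) := by
  have : IntegrableOn (fun l : ℝ => Real.exp (-l ^ α)) (Ioi 0) := by
    simpa using integrableOn_rpow_mul_exp hα (s := 0) (by norm_num)
  exact this.integrable_comp_abs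

theorem fourier_exp_neg_abs_rpow (hα : 1 < α) (x : ℝ) :
    FourierTransform.fourier (fun l : ℝ => (Real.exp (-|l| ^ α) : ℂ)) (x / (2 * Real.pi))
      = ((2 * Real.pi * stableDensity α 1 x : ℝ) : ℂ) := by
  have hE := integrable_exp_neg_abs_rpow hα
  have hi : Integrable fun l : ℝ => Complex.exp (-(l * x * Complex.I)) * Real.exp (-|l| ^ α) := by
    refine hE.ofReal.bdd_mul (c := 1) (by fun_prop) (ae_of_all _ fun l => ?_)
    rw [← neg_mul, ← Complex.ofReal_mul, ← Complex.ofReal_neg, Complex.norm_exp_ofReal_mul_I]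
  -- Pairing `l` with `-l` replaces the complex exponential by a cosine.
  have hc : ∀ l : ℝ, Complex.exp (-(l * x * Complex.I)) * Real.exp (-|l| ^ α)
      + Complex.exp (-((-l : ℝ) * x * Complex.I)) * Real.exp (-|-l| ^ α)
      = ((2 * (Real.cos (l * x) * Real.exp (-1 * |l| ^ α)) : ℝ) : ℂ) := by
    intro l
    push_cast
    rw [abs_neg, Complex.cos]
    ring_nf
  have h2 : (2 : ℂ) * ∫ l : ℝ, Complex.exp (-(l * x * Complex.I)) * Real.exp (-|l| ^ α)
      = ((2 * ∫ l : ℝ, Real.cos (l * x) * Real.exp (-1 * |l| ^ α) : ℝ) : ℂ) := by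
    rw [← integral_const_mul (2 : ℝ), ← integral_complex_ofReal]
    simp_rw [← hc]
    rw [integral_add hi hi.comp_neg, two_mul]
    congr 1
    exact (integral_neg_eq_self
      (fun l : ℝ => Complex.exp (-(l * x * Complex.I)) * Real.exp (-|l| ^ α)) volume).symm
  rw [Real.fourier_real_eq_integral_exp_smul, stableDensity]
  have hpi : Real.pi ≠ 0 := Real.pi_ne_zero
  rw [← mul_assoc, mul_inv_cancel₀ (by positivity), one_mul]
  rw [Complex.ofReal_mul, Complex.ofReal_ofNat] at h2
  rw [← mul_left_cancel₀ two_ne_zero h2]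
  congr 1; ext l
  rw [smul_eq_mul]
  congr 2
  rw [show -2 * Real.pi * l * (x / (2 * Real.pi)) = -(l * x) by field_simp]
  push_cast
  ring

/-- Fourier inversion, applicable since the characteristic function is continuous and integrable and
its transform, the density, is integrable. The factors `2π` come from the `exp (-2πi l w)`
normalisation. -/
theorem integral_stableDensity_smul_cexp (hα : 1 < α) (l : ℝ) :
    ∫ x : ℝ, stableDensity α 1 x • Complex.exp (l * x * Complex.I) = Real.exp (-|l| ^ α) := by
  have hpi : 0 < 2 * Real.pi := by positivity
  set φ : ℝ → ℂ := fun l : ℝ => (Real.exp (-|l| ^ α) : ℂ) with hφ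
  have hF : ∀ w, FourierTransform.fourier φ w
      = ((2 * Real.pi * stableDensity α 1 (w * (2 * Real.pi)) : ℝ) : ℂ) := fun w => by
    rw [← fourier_exp_neg_abs_rpow hα, mul_div_cancel_right₀ _ hpi.ne']
  have hφc : Continuous φ := by
    refine Complex.continuous_ofReal.comp (Real.continuous_exp.comp (Continuous.neg ?_))
    exact (Real.continuous_rpow_const (by linarith)).comp continuous_abs
  have hFi : Integrable (FourierTransform.fourier φ) := by
    rw [show FourierTransform.fourier φ = _ from funext hF]
    exact (((integrable_stableDensity hα).comp_mul_right' hpi.ne').const_mul _).ofReal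
  have hinv := congrFun (hφc.fourierInv_fourier_eq (integrable_exp_neg_abs_rpow hα).ofReal hFi) l
  rw [Real.fourierInv_eq'] at hinv
  rw [← show φ l = Real.exp (-|l| ^ α) from rfl, ← hinv]
  have := Measure.integral_comp_mul_right
    (fun x : ℝ => stableDensity α 1 x • Complex.exp (l * x * Complex.I)) (2 * Real.pi)
  rw [abs_of_pos (inv_pos.2 hpi), eq_inv_smul_iff₀ hpi.ne', ← integral_smul] at this
  rw [← this]
  congr 1; ext w
  rw [hF]
  simp only [Complex.real_smul, smul_eq_mul, RCLike.inner_apply, conj_trivial]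
  push_cast
  rw [show (l : ℂ) * (w * (2 * Real.pi)) * Complex.I = 2 * Real.pi * (l * w) * Complex.I by ring]
  ring

theorem charFun_withDensity_ofReal {f : ℝ → ℝ} (hf : Measurable f) (l : ℝ) :
    charFun (volume.withDensity fun x => ENNReal.ofReal (f x)) l
      = ∫ x : ℝ, (max (f x) 0) • Complex.exp (l * x * Complex.I) := by
  rw [charFun_apply_real, integral_withDensity_eq_integral_toReal_smul
    hf.ennreal_ofReal (ae_of_all _ fun _ => ENNReal.ofReal_lt_top)]
  rfl

/-- The standard stable law has density `stableDensity α 1`, which is nonnegative. -/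
theorem IsStandardStable.nonneg_and_eq_withDensity (hα : 1 < α) {μ : Measure ℝ}
    (hμ : IsStandardStable α μ) :
    (∀ x, 0 ≤ stableDensity α 1 x) ∧
      μ = volume.withDensity fun x => ENNReal.ofReal (stableDensity α 1 x) := by
  have := hμ.1
  set P := stableDensity α 1
  have hPc : Continuous P := continuous_stableDensity hα
  have hPi : Integrable P := integrable_stableDensity hα
  set ν₁ := volume.withDensity fun x => ENNReal.ofReal (P x) with hν₁
  set ν₂ := volume.withDensity fun x => ENNReal.ofReal (-P x) with hν₂
  have : IsFiniteMeasure ν₁ := isFiniteMeasure_withDensity_ofReal hPi.2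
  have : IsFiniteMeasure ν₂ := isFiniteMeasure_withDensity_ofReal hPi.neg.2
  have hexp : ∀ l : ℝ, ∀ x : ℝ, ‖Complex.exp (l * x * Complex.I)‖ ≤ 1 := fun l x => by
    rw [← Complex.ofReal_mul, Complex.norm_exp_ofReal_mul_I]
  have hint : ∀ {g : ℝ → ℝ}, Integrable g → ∀ l : ℝ,
      Integrable fun x : ℝ => g x • Complex.exp (l * x * Complex.I) := fun hg l => by
    simp_rw [Complex.real_smul]
    exact hg.ofReal.mul_bdd (c := 1) (by fun_prop) (ae_of_all _ (hexp l))
  -- The sign of `P` is not yet known, so the negative part is moved to the other side; then both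
  -- sides are finite positive measures and characteristic functions determine them.
  have key : μ + ν₂ = ν₁ := by
    refine Measure.ext_of_charFun (funext fun l => ?_)
    have hadd : charFun (μ + ν₂) l = charFun μ l + charFun ν₂ l := by
      simp only [charFun_apply_real]
      exact integral_add_measure
        ((integrable_const (1 : ℝ)).mono' (by fun_prop) (ae_of_all _ (hexp l)))
        ((integrable_const (1 : ℝ)).mono' (by fun_prop) (ae_of_all _ (hexp l)))
    rw [hadd, hμ.2 l, charFun_withDensity_ofReal hPc.measurable,
      charFun_withDensity_ofReal hPc.measurable.fun_neg,
      ← integral_stableDensity_smul_cexp hα]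
    refine (integral_add (hint hPi l) (hint hPi.neg.pos_part l)).symm.trans ?_
    congr 1; ext x
    rw [← add_smul]
    congr 1
    change P x + max (-P x) 0 = max (P x) 0
    rcases le_total 0 (P x) with h | h
    · rw [max_eq_right (by linarith), max_eq_left h, add_zero]
    · rw [max_eq_left (by linarith), max_eq_right h, add_neg_cancel]
  -- `{P < 0}` is null for `ν₁`, hence for `ν₂ ≤ ν₁`, whose density is positive there. So it is
  -- Lebesgue-null, and being open it is empty.
  have hnn : ∀ x, 0 ≤ P x := by
    have ho : IsOpen {x | P x < 0} := isOpen_lt hPc continuous_const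
    have h1 : ν₁ {x | P x < 0} = 0 := by
      rw [withDensity_apply _ ho.measurableSet]
      refine setLIntegral_eq_zero ho.measurableSet fun x hx => ?_
      exact ENNReal.ofReal_of_nonpos (le_of_lt hx)
    have h2 : ν₂ {x | P x < 0} = 0 := by
      refine le_antisymm ?_ bot_le
      rw [← h1, ← key]
      exact Measure.le_add_left le_rfl _
    rw [withDensity_apply_eq_zero hPc.measurable.fun_neg.ennreal_ofReal] at h2
    have h3 : {x | ENNReal.ofReal (-P x) ≠ 0} ∩ {x | P x < 0} = {x | P x < 0} := by
      refine inter_eq_right.2 fun x hx => ?_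
      simpa using hx
    rw [h3, ho.measure_eq_zero_iff volume] at h2
    intro x
    by_contra hx
    exact (h2 ▸ (show x ∈ {x | P x < 0} from not_le.1 hx) : x ∈ (∅ : Set ℝ))
  refine ⟨hnn, ?_⟩
  have : ν₂ = 0 := by
    rw [hν₂]
    convert! withDensity_zero using 2
    ext x
    exact ENNReal.ofReal_of_nonpos (neg_nonpos.2 (hnn x))
  rw [← key, this, add_zero]

end Density

/-! ### First moment of the stable law and integrals against it. -/

/-- Keep only `l ≤ π/|x|`, where `1 - cos θ ≥ 2θ²/π²` applies to `θ = l x`. This controls `|x|` by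
quantities whose `μ`-mean is known from the characteristic function. -/
theorem ofReal_abs_le_lintegral_one_sub_cos (x : ℝ) :
    ENNReal.ofReal (2 / Real.pi * |x|)
      ≤ ∫⁻ l in Ioi (0 : ℝ), ENNReal.ofReal ((1 - Real.cos (l * x)) / l ^ 2) := by
  rcases eq_or_ne x 0 with rfl | hx
  · simp
  have hx' : 0 < |x| := abs_pos.2 hx
  have hpi := Real.pi_pos
  calc ENNReal.ofReal (2 / Real.pi * |x|)
      = ∫⁻ l in Ioc (0 : ℝ) (Real.pi / |x|), ENNReal.ofReal (2 / Real.pi ^ 2 * x ^ 2) := by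
        rw [setLIntegral_const, Real.volume_Ioc, sub_zero, ← ENNReal.ofReal_mul (by positivity),
          ← sq_abs x]
        congr 1
        field_simp
    _ ≤ ∫⁻ l in Ioc (0 : ℝ) (Real.pi / |x|), ENNReal.ofReal ((1 - Real.cos (l * x)) / l ^ 2) := by
        refine setLIntegral_mono' measurableSet_Ioc fun l hl => ENNReal.ofReal_le_ofReal ?_
        have hl0 : 0 < l := hl.1
        have h : |l * x| ≤ Real.pi := by
          rw [abs_mul, abs_of_pos hl0, ← le_div_iff₀ hx']
          exact hl.2
        have := Real.cos_le_one_sub_mul_cos_sq h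
        rw [le_div_iff₀ (by positivity)]
        linarith [mul_pow l x 2]
    _ ≤ _ := lintegral_mono_set Ioc_subset_Ioi_self

section Moments

variable {α : ℝ} {μ : Measure ℝ}

theorem IsStandardStable.integral_cos (hμ : IsStandardStable α μ) (l : ℝ) :
    ∫ x, Real.cos (l * x) ∂μ = Real.exp (-|l| ^ α) := by
  have := hμ.1
  have h := congrArg Complex.re (hμ.2 l)
  rw [charFun_apply_real, Complex.ofReal_re, ← RCLike.re_to_complex, ← integral_re] at h
  · rw [← h]
    congr 1; ext x
    rw [RCLike.re_to_complex, ← Complex.ofReal_mul, Complex.exp_ofReal_mul_I_re]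
  · refine (integrable_const (1 : ℝ)).mono' (by fun_prop) (ae_of_all _ fun x => ?_)
    rw [← Complex.ofReal_mul, Complex.norm_exp_ofReal_mul_I]

/-- Near `0` the integrand is at most `l ^ (α - 2)`, integrable because `1 < α`; on `(1, ∞)` it is
at most `l ^ (-2)`. -/
theorem integrableOn_one_sub_exp_div_sq (hα : 1 < α) :
    IntegrableOn (fun l : ℝ => (1 - Real.exp (-|l| ^ α)) / l ^ 2) (Ioi 0) := by
  have hm : Measurable fun l : ℝ => (1 - Real.exp (-|l| ^ α)) / l ^ 2 := by
    have : Measurable fun l : ℝ => |l| := measurable_norm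
    fun_prop
  rw [← Ioc_union_Ioi_eq_Ioi zero_le_one]
  refine IntegrableOn.union ?_ ?_
  · have h1 : IntegrableOn (fun l : ℝ => l ^ (α - 2)) (Ioc 0 1) := by
      rw [← intervalIntegrable_iff_integrableOn_Ioc_of_le zero_le_one]
      exact intervalIntegral.intervalIntegrable_rpow' (by linarith)
    refine h1.mono' hm.aestronglyMeasurable ?_
    filter_upwards [ae_restrict_mem measurableSet_Ioc] with l hl
    have hl0 : 0 < l := hl.1
    have h2 := Real.add_one_le_exp (-|l| ^ α)
    have h3 : Real.exp (-|l| ^ α) ≤ 1 := Real.exp_le_one_iff.2 (by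
      simpa using Real.rpow_nonneg (abs_nonneg l) α)
    rw [Real.norm_of_nonneg (div_nonneg (by linarith) (sq_nonneg l)), Real.rpow_sub hl0,
      Real.rpow_two]
    gcongr
    rw [abs_of_pos hl0] at h2 ⊢
    linarith
  · refine (integrableOn_Ioi_rpow_of_lt (a := -2) (by norm_num) one_pos).mono'
      hm.aestronglyMeasurable ?_
    filter_upwards [ae_restrict_mem measurableSet_Ioi] with l hl
    have hl0 : 0 < l := one_pos.trans hl
    have h2 := Real.exp_pos (-|l| ^ α)
    have h3 : Real.exp (-|l| ^ α) ≤ 1 := Real.exp_le_one_iff.2 (by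
      simpa using Real.rpow_nonneg (abs_nonneg l) α)
    rw [Real.norm_of_nonneg (div_nonneg (by linarith) (sq_nonneg l)), Real.rpow_neg hl0.le,
      Real.rpow_two, ← one_div]
    gcongr
    linarith

theorem IsStandardStable.integrable_id (hα : 1 < α) (hμ : IsStandardStable α μ) :
    Integrable (fun x : ℝ => x) μ := by
  have := hμ.1
  have hpi := Real.pi_pos
  have hfin : ∫⁻ x, ENNReal.ofReal (2 / Real.pi * |x|) ∂μ < ∞ := by
    calc _ ≤ ∫⁻ x, (∫⁻ l in Ioi (0 : ℝ), ENNReal.ofReal ((1 - Real.cos (l * x)) / l ^ 2)) ∂μ :=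
          lintegral_mono fun x => ofReal_abs_le_lintegral_one_sub_cos x
      _ = ∫⁻ l in Ioi (0 : ℝ), ∫⁻ x, ENNReal.ofReal ((1 - Real.cos (l * x)) / l ^ 2) ∂μ := by
          refine lintegral_lintegral_swap (Measurable.aemeasurable ?_)
          simp only [Function.uncurry_def]
          fun_prop
      _ = ∫⁻ l in Ioi (0 : ℝ), ENNReal.ofReal ((1 - Real.exp (-|l| ^ α)) / l ^ 2) := by
          congr 1; ext l
          have hc : Integrable (fun x => Real.cos (l * x)) μ :=
            (integrable_const (1 : ℝ)).mono' (by fun_prop)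
              (ae_of_all _ fun x => Real.abs_cos_le_one _)
          have hs : Integrable (fun x => (1 - Real.cos (l * x)) / l ^ 2) μ :=
            ((integrable_const 1).sub hc).div_const _
          rw [← hμ.integral_cos, ← ofReal_integral_eq_lintegral_ofReal hs (ae_of_all _ fun x =>
              div_nonneg (sub_nonneg.2 (Real.cos_le_one _)) (sq_nonneg l)), integral_div]
          congr 2
          exact (integral_sub (integrable_const 1) hc).trans (by simp)
      _ < ∞ := (integrableOn_one_sub_exp_div_sq hα).lintegral_lt_top
  have hi : Integrable (fun x => 2 / Real.pi * |x|) μ := by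
    refine ⟨by fun_prop, ?_⟩
    rwa [hasFiniteIntegral_iff_ofReal (ae_of_all _ fun x => by positivity)]
  refine hi.const_mul (Real.pi / 2) |>.mono' (by fun_prop) (ae_of_all _ fun x => ?_)
  rw [← mul_assoc, show Real.pi / 2 * (2 / Real.pi) = 1 by field_simp, one_mul]
  exact le_rfl

theorem LipschitzWith.abs_sub_le {h : ℝ → ℝ} {K : ℝ≥0} (hh : LipschitzWith K h) (x y : ℝ) :
    |h x - h y| ≤ K * |x - y| := hh.dist_le_mul x y

theorem LipschitzWith.integrable_of_integrable_id {h : ℝ → ℝ} {K : ℝ≥0} (hh : LipschitzWith K h)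
    [IsFiniteMeasure μ] (hid : Integrable (fun x : ℝ => x) μ) : Integrable h μ := by
  refine ((hid.norm.const_mul K).add (integrable_const |h 0|)).mono'
    hh.continuous.aestronglyMeasurable (ae_of_all _ fun x => ?_)
  have h1 := hh.abs_sub_le x 0
  rw [sub_zero] at h1
  have h2 := abs_sub_abs_le_abs_sub (h x) (h 0)
  simp only [Pi.add_apply, Real.norm_eq_abs]
  linarith

theorem IsStandardStable.integrable_iff (hα : 1 < α) (hμ : IsStandardStable α μ) (g : ℝ → ℝ) :
    Integrable g μ ↔ Integrable fun z => stableDensity α 1 z * g z := by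
  obtain ⟨hnn, heq⟩ := hμ.nonneg_and_eq_withDensity hα
  conv_lhs => rw [heq]
  rw [integrable_withDensity_iff_integrable_smul'
    (continuous_stableDensity hα).measurable.ennreal_ofReal
    (ae_of_all _ fun _ => ENNReal.ofReal_lt_top)]
  simp [ENNReal.toReal_ofReal (hnn _)]

theorem IsStandardStable.integral_eq (hα : 1 < α) (hμ : IsStandardStable α μ) (g : ℝ → ℝ) :
    ∫ z, g z ∂μ = ∫ z, stableDensity α 1 z * g z := by
  obtain ⟨hnn, heq⟩ := hμ.nonneg_and_eq_withDensity hα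
  conv_lhs => rw [heq]
  rw [integral_withDensity_eq_integral_toReal_smul
    (continuous_stableDensity hα).measurable.ennreal_ofReal
    (ae_of_all _ fun _ => ENNReal.ofReal_lt_top)]
  simp [ENNReal.toReal_ofReal (hnn _)]

theorem IsStandardStable.absolutelyContinuous (hα : 1 < α) (hμ : IsStandardStable α μ) :
    μ ≪ volume := by
  rw [(hμ.nonneg_and_eq_withDensity hα).2]
  exact withDensity_absolutelyContinuous _ _

theorem IsStandardStable.integrable_stableDensity_mul (hα : 1 < α) (hμ : IsStandardStable α μ)
    {c : ℝ} (hc : 0 < c) (a : ℝ) {g : ℝ → ℝ} (hg : Integrable (fun z => g (c * z + a)) μ) :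
    Integrable fun y => stableDensity α (c ^ α) (y - a) * g y := by
  rw [hμ.integrable_iff hα] at hg
  refine (((hg.comp_div hc.ne').comp_sub_right a).const_mul c⁻¹).congr (ae_of_all _ fun y => ?_)
  simp only
  rw [stableDensity_rpow α hc, mul_div_cancel₀ _ hc.ne', sub_add_cancel, mul_assoc]

/-- The substitution `y = c z + a` combined with self-similarity of the density; this is the source
of Mehler's formula. -/
theorem IsStandardStable.integral_stableDensity_mul (hα : 1 < α) (hμ : IsStandardStable α μ)
    {c : ℝ} (hc : 0 < c) (a : ℝ) (g : ℝ → ℝ) :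
    ∫ y, stableDensity α (c ^ α) (y - a) * g y = ∫ z, g (c * z + a) ∂μ := by
  rw [hμ.integral_eq hα]
  have h1 := Measure.integral_comp_div (fun z => stableDensity α 1 z * g (c * z + a)) c
  rw [← integral_sub_right_eq_self _ a, abs_of_pos hc, smul_eq_mul] at h1
  rw [← inv_mul_cancel_left₀ hc.ne' (∫ z, stableDensity α 1 z * g (c * z + a)), ← h1,
    ← integral_const_mul]
  congr 1; ext y
  rw [stableDensity_rpow α hc, mul_div_cancel₀ _ hc.ne', sub_add_cancel, mul_assoc]

end Moments

/-! ### The Beta integral in the time variable. -/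

theorem setIntegral_rpow_mul_rpow_eq_beta {a b : ℝ} (ha : 0 < a) (hb : 0 < b) :
    ∫ x in Ioo (0 : ℝ) 1, x ^ (a - 1) * (1 - x) ^ (b - 1) = ProbabilityTheory.beta a b := by
  rw [ProbabilityTheory.beta_eq_betaIntegralReal a b ha hb,
    Complex.betaIntegral, intervalIntegral.integral_of_le (by norm_num),
    ← integral_Ioc_eq_integral_Ioo, ← RCLike.re_to_complex, ← integral_re]
  · refine setIntegral_congr_fun measurableSet_Ioc fun x ⟨hx1, hx₂⟩ ↦ ?_
    norm_cast
    rw [← Complex.ofReal_cpow, ← Complex.ofReal_cpow, RCLike.re_to_complex,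
      Complex.re_mul_ofReal, Complex.ofReal_re]
    all_goals linarith
  convert! Complex.betaIntegral_convergent (u := a) (v := b) (by simpa) (by simpa)
  rw [intervalIntegrable_iff_integrableOn_Ioc_of_le (by simp), IntegrableOn]

theorem image_one_sub_exp_neg_Ioi :
    (fun t : ℝ => 1 - Real.exp (-t)) '' Ioi 0 = Ioo 0 1 := by
  ext u
  constructor
  · rintro ⟨t, ht, rfl⟩
    have := Real.exp_lt_one_iff.2 (neg_lt_zero.2 (mem_Ioi.1 ht))
    exact ⟨by simpa using ht, by simpa using Real.exp_pos _⟩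
  · rintro ⟨h0, h1⟩
    refine ⟨-Real.log (1 - u), ?_, ?_⟩
    · exact neg_pos.2 (Real.log_neg (by linarith) (by linarith))
    · simp only [neg_neg]
      rw [Real.exp_log (by linarith)]
      ring

theorem integral_exp_mul_one_sub_exp_rpow {a b : ℝ} (ha : 0 < a) (hb : 0 < b) :
    ∫ t in Ioi (0 : ℝ), Real.exp (-b * t) * (1 - Real.exp (-t)) ^ (a - 1)
      = ProbabilityTheory.beta a b := by
  have hd : ∀ t ∈ Ioi (0 : ℝ),
      HasDerivWithinAt (fun t : ℝ => 1 - Real.exp (-t)) (Real.exp (-t)) (Ioi 0) t := fun t _ => by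
    simpa using ((hasDerivAt_neg t).exp.const_sub 1).hasDerivWithinAt
  have hinj : InjOn (fun t : ℝ => 1 - Real.exp (-t)) (Ioi 0) := fun s _ t _ hst => by
    simpa using hst
  rw [← setIntegral_rpow_mul_rpow_eq_beta ha hb, ← image_one_sub_exp_neg_Ioi,
    integral_image_eq_integral_abs_deriv_smul measurableSet_Ioi hd hinj]
  refine setIntegral_congr_fun measurableSet_Ioi fun t _ => ?_
  simp only [smul_eq_mul, sub_sub_cancel, abs_of_pos (Real.exp_pos _)]
  rw [← Real.exp_mul, mul_left_comm, ← Real.exp_add, mul_comm]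
  congr 2
  ring

theorem integrableOn_exp_mul_one_sub_exp_rpow {a b : ℝ} (ha : 0 < a) (hb : 0 < b) :
    IntegrableOn (fun t : ℝ => Real.exp (-b * t) * (1 - Real.exp (-t)) ^ (a - 1)) (Ioi 0) := by
  -- A non-integrable function has integral `0` by convention, whereas the Beta value is positive.
  by_contra h
  have := integral_exp_mul_one_sub_exp_rpow ha hb
  rw [integral_undef h] at this
  exact (ProbabilityTheory.beta_pos ha hb).ne this

/-! ### Differentiating a convolution with the density. -/

section Translation

variable {α : ℝ}

theorem inv_one_add_sq_le {u v : ℝ} (h : |u - v| ≤ 1) :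
    (1 + u ^ 2)⁻¹ ≤ 4 * (1 + v ^ 2)⁻¹ := by
  rw [← div_eq_mul_inv, inv_le_comm₀ (by positivity) (by positivity), inv_div,
    div_le_iff₀ (by norm_num)]
  have h3 : (u - v) ^ 2 ≤ 1 := (sq_le_one_iff_abs_le_one _).2 h
  nlinarith [sq_nonneg (2 * u - v), sq_nonneg u]

/-- Translating the variable puts `y` into the density, so `φ` needs no regularity. For shifts of
size at most `1`, `inv_one_add_sq_le` supplies a single integrable majorant. -/
theorem hasDerivAt_integral_comp_add_mul_stableDensity (hα : 1 < α) (hα₂ : α < 2) {φ : ℝ → ℝ}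
    {M : ℝ} (hφ : Measurable φ) (hM : ∀ x, |φ x| ≤ M) (y : ℝ) :
    HasDerivAt (fun y => ∫ z, φ (z + y) * stableDensity α 1 z)
      (-∫ z, φ (z + y) * stableDensityDeriv α z) y := by
  obtain ⟨C, hC0, hC⟩ := exists_abs_stableDensityDeriv_le hα hα₂
  have hM0 : 0 ≤ M := (abs_nonneg _).trans (hM 0)
  have e : ∀ g : ℝ → ℝ, ∀ y, ∫ z, φ (z + y) * g z = ∫ w, φ w * g (w - y) := fun g y => by
    rw [← integral_sub_right_eq_self (fun z => φ (z + y) * g z) y]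
    simp
  simp only [e, ← integral_neg]
  have hPc := continuous_stableDensity hα
  have hP'm := measurable_stableDensityDeriv α
  refine (hasDerivAt_integral_of_dominated_loc_of_deriv_le (s := Metric.ball y 1)
    (F := fun y w => φ w * stableDensity α 1 (w - y))
    (F' := fun y w => -(φ w * stableDensityDeriv α (w - y)))
    (bound := fun w => M * (C * (4 * (1 + (w - y) ^ 2)⁻¹))) (Metric.ball_mem_nhds y one_pos)
    (Filter.Eventually.of_forall fun y' => ?_) ?_ ?_ ?_ ?_ ?_).2
  · exact (hφ.mul (hPc.measurable.comp (measurable_id.sub_const y'))).aestronglyMeasurable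
  · exact ((integrable_stableDensity hα).comp_sub_right y).bdd_mul (c := M)
      hφ.aestronglyMeasurable (ae_of_all _ hM)
  · exact (hφ.mul (hP'm.comp (measurable_id.sub_const y))).neg.aestronglyMeasurable
  · refine ae_of_all _ fun w y' hy' => ?_
    rw [norm_neg, norm_mul]
    refine mul_le_mul (hM w) ((hC _).trans ?_) (norm_nonneg _) hM0
    refine mul_le_mul_of_nonneg_left (inv_one_add_sq_le ?_) hC0
    rw [sub_sub_sub_cancel_left, abs_sub_comm, ← Real.dist_eq]
    exact (Metric.mem_ball.1 hy').le
  · exact (((integrable_inv_one_add_sq.comp_sub_right y).const_mul 4).const_mul C).const_mul M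
  · refine ae_of_all _ fun w y' _ => ?_
    refine (((hasDerivAt_stableDensity hα (w - y')).comp_const_sub w y').const_mul
      (φ w)).congr_deriv (by ring)

end Translation

/-! ### The Ornstein-Uhlenbeck semigroup and the derivatives of the Stein solution. -/

section Semigroup

variable {α : ℝ} {μ : Measure ℝ} {h : ℝ → ℝ} {K : ℝ≥0}

/-- The contraction factor `exp (-t / α)` of the Ornstein-Uhlenbeck semigroup. -/
noncomputable def ouDrift (α t : ℝ) : ℝ := Real.exp (-t / α)

/-- The noise scale `(1 - exp (-t)) ^ (1 / α)` of the Ornstein-Uhlenbeck semigroup. -/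
noncomputable def ouScale (α t : ℝ) : ℝ := (1 - Real.exp (-t)) ^ (1 / α)

theorem ouDrift_pos (α t : ℝ) : 0 < ouDrift α t := Real.exp_pos _

theorem one_sub_exp_neg_pos {t : ℝ} (ht : 0 < t) : 0 < 1 - Real.exp (-t) :=
  sub_pos.2 (Real.exp_lt_one_iff.2 (neg_lt_zero.2 ht))

theorem ouScale_pos (α : ℝ) {t : ℝ} (ht : 0 < t) : 0 < ouScale α t :=
  Real.rpow_pos_of_pos (one_sub_exp_neg_pos ht) _

theorem ouScale_rpow (hα : 1 < α) {t : ℝ} (ht : 0 < t) :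
    ouScale α t ^ α = 1 - Real.exp (-t) := by
  rw [ouScale, ← Real.rpow_mul (one_sub_exp_neg_pos ht).le, one_div,
    inv_mul_cancel₀ (by linarith), Real.rpow_one]

theorem abs_ouScale_sub_one_le (hα : 1 < α) {t : ℝ} (ht : 0 < t) :
    |ouScale α t - 1| ≤ Real.exp (-t) := by
  have h0 := one_sub_exp_neg_pos ht
  have h1 : 1 - Real.exp (-t) ≤ 1 := by linarith [Real.exp_pos (-t)]
  have h2 : ouScale α t ≤ 1 := Real.rpow_le_one h0.le h1 (by positivity)
  have h3 : 1 - Real.exp (-t) ≤ ouScale α t := by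
    have := Real.rpow_le_rpow_of_exponent_ge h0 h1 (show 1 / α ≤ 1 by
      rw [div_le_one (by linarith)]; exact hα.le)
    rwa [Real.rpow_one] at this
  rw [abs_le]
  constructor <;> linarith

@[fun_prop]
theorem measurable_ouDrift (α : ℝ) : Measurable (ouDrift α) := by
  unfold ouDrift; fun_prop

@[fun_prop]
theorem measurable_ouScale (α : ℝ) : Measurable (ouScale α) := by
  unfold ouScale; fun_prop

theorem integrableOn_ouDrift (hα : 1 < α) : IntegrableOn (ouDrift α) (Ioi 0) := by
  have := integrableOn_exp_mul_Ioi (a := -(1 / α)) (neg_lt_zero.2 (by positivity)) 0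
  refine this.congr_fun (fun t _ => ?_) measurableSet_Ioi
  simp only [ouDrift]
  congr 1; ring

theorem integral_ouDrift (hα : 1 < α) : ∫ t in Ioi (0 : ℝ), ouDrift α t = α := by
  have := integral_exp_mul_Ioi (a := -(1 / α)) (neg_lt_zero.2 (by positivity)) 0
  rw [mul_zero, Real.exp_zero] at this
  have e : ∀ t, ouDrift α t = Real.exp (-(1 / α) * t) := fun t => by
    rw [ouDrift]; congr 1; ring
  simp only [e, this]
  field_simp

theorem ouDrift_mul_div_eq (hα : 1 < α) {t : ℝ} (ht : 0 < t) :
    ouDrift α t * (ouDrift α t / ouScale α t)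
      = Real.exp (-(2 / α) * t) * (1 - Real.exp (-t)) ^ ((α - 1) / α - 1) := by
  have : (α - 1) / α - 1 = -(1 / α) := by field_simp; ring
  rw [this, Real.rpow_neg (one_sub_exp_neg_pos ht).le, ← mul_div_assoc, div_eq_mul_inv, ouDrift,
    ← Real.exp_add, ouScale]
  congr 2; ring

theorem integrableOn_ouDrift_mul_div (hα : 1 < α) :
    IntegrableOn (fun t => ouDrift α t * (ouDrift α t / ouScale α t)) (Ioi 0) :=
  (integrableOn_exp_mul_one_sub_exp_rpow (a := (α - 1) / α) (b := 2 / α)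
    (div_pos (by linarith) (by linarith)) (by positivity)).congr_fun
    (fun _ ht => (ouDrift_mul_div_eq hα ht).symm) measurableSet_Ioi

theorem integral_ouDrift_mul_div (hα : 1 < α) :
    ∫ t in Ioi (0 : ℝ), ouDrift α t * (ouDrift α t / ouScale α t)
      = ProbabilityTheory.beta ((α - 1) / α) (2 / α) := by
  rw [← integral_exp_mul_one_sub_exp_rpow (div_pos (by linarith) (by linarith)) (by positivity)]
  exact setIntegral_congr_fun measurableSet_Ioi fun t ht => ouDrift_mul_div_eq hα ht

/-- Mehler's formula: the Ornstein-Uhlenbeck semigroup with invariant law `μ` at time `t`. -/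
noncomputable def ouSemigroup (α : ℝ) (μ : Measure ℝ) (φ : ℝ → ℝ) (t x : ℝ) : ℝ :=
  ∫ z, φ (ouScale α t * z + ouDrift α t * x) ∂μ

theorem stronglyMeasurable_ouSemigroup [SFinite μ] {φ : ℝ → ℝ} (hφ : Measurable φ) (x : ℝ) :
    StronglyMeasurable fun t => ouSemigroup α μ φ t x := by
  have : Measurable fun p : ℝ × ℝ => φ (ouScale α p.1 * p.2 + ouDrift α p.1 * x) := by fun_prop
  exact this.stronglyMeasurable.integral_prod_right'

theorem LipschitzWith.integrable_comp_affine [IsFiniteMeasure μ] (hh : LipschitzWith K h)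
    (hid : Integrable (fun x : ℝ => x) μ) (c a : ℝ) : Integrable (fun z => h (c * z + a)) μ := by
  refine (((hid.const_mul c).norm.add (integrable_const |a|)).const_mul K |>.add
    (integrable_const |h 0|)).mono' ?_ (ae_of_all _ fun z => ?_)
  · exact (hh.continuous.comp (by fun_prop)).aestronglyMeasurable
  have h1 := hh.abs_sub_le (c * z + a) 0
  rw [sub_zero] at h1
  have h2 := abs_sub_abs_le_abs_sub (h (c * z + a)) (h 0)
  have h3 := mul_le_mul_of_nonneg_left (abs_add_le (c * z) a) K.coe_nonneg
  simp only [Pi.add_apply, Real.norm_eq_abs]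
  linarith

theorem IsStandardStable.integrable_steinIntegrand (hα : 1 < α) (hμ : IsStandardStable α μ)
    (hh : LipschitzWith K h) (x : ℝ) {t : ℝ} (ht : 0 < t) :
    Integrable (steinIntegrand α μ h x t) := by
  have := hμ.1
  have hi := hμ.integrable_stableDensity_mul hα (ouScale_pos α ht) (ouDrift α t * x)
    (g := fun y => h y - ∫ z, h z ∂μ)
    ((hh.integrable_comp_affine (hμ.integrable_id hα) _ _).sub (integrable_const _))
  rw [ouScale_rpow hα ht] at hi
  exact hi

theorem IsStandardStable.integral_steinIntegrand (hα : 1 < α) (hμ : IsStandardStable α μ)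
    (hh : LipschitzWith K h) (x : ℝ) {t : ℝ} (ht : 0 < t) :
    ∫ y, steinIntegrand α μ h x t y = ouSemigroup α μ h t x - ∫ z, h z ∂μ := by
  have := hμ.1
  have hi := hμ.integral_stableDensity_mul hα (ouScale_pos α ht) (ouDrift α t * x)
    (fun y => h y - ∫ z, h z ∂μ)
  rw [ouScale_rpow hα ht, integral_sub (hh.integrable_comp_affine (hμ.integrable_id hα) _ _)
    (integrable_const _)] at hi
  simp only [integral_const, probReal_univ, one_smul] at hi
  exact hi

/-- Couple both terms through the same `z`: the Lipschitz bound gives at most `K (|c - 1| |z| + b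
|x|)`, and both `|c - 1| ≤ e^{-t}` and `b` are integrable in time. -/
theorem integrableOn_ouSemigroup_sub [IsProbabilityMeasure μ] (hα : 1 < α)
    (hid : Integrable (fun x : ℝ => x) μ) (hh : LipschitzWith K h) (x : ℝ) :
    IntegrableOn (fun t => ouSemigroup α μ h t x - ∫ z, h z ∂μ) (Ioi 0) := by
  have hexp : IntegrableOn (fun t : ℝ => Real.exp (-t)) (Ioi 0) := integrableOn_exp_neg_Ioi 0
  refine (((hexp.mul_const (∫ z, |z| ∂μ)).add
    ((integrableOn_ouDrift hα).mul_const |x|)).const_mul K).mono'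
    ((stronglyMeasurable_ouSemigroup hh.continuous.measurable x).aestronglyMeasurable.sub
      aestronglyMeasurable_const) ?_
  filter_upwards [ae_restrict_mem measurableSet_Ioi] with t ht
  have hi : Integrable (fun z => K * (Real.exp (-t) * |z| + ouDrift α t * |x|)) μ :=
    ((hid.norm.const_mul _).add (integrable_const _)).const_mul _
  have hval : ∫ z, K * (Real.exp (-t) * |z| + ouDrift α t * |x|) ∂μ
      = K * (Real.exp (-t) * (∫ z, |z| ∂μ) + ouDrift α t * |x|) := by
    rw [integral_const_mul, integral_add (hid.abs.const_mul _) (integrable_const _),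
      integral_const_mul]
    simp
  simp only [Pi.add_apply]
  rw [ouSemigroup, ← integral_sub (hh.integrable_comp_affine hid _ _)
    (hh.integrable_of_integrable_id hid), ← hval]
  refine norm_integral_le_of_norm_le hi (ae_of_all _ fun z => ?_)
  refine (hh.abs_sub_le _ _).trans (mul_le_mul_of_nonneg_left ?_ K.coe_nonneg)
  rw [show ouScale α t * z + ouDrift α t * x - z = (ouScale α t - 1) * z + ouDrift α t * x by ring]
  refine (abs_add_le _ _).trans ?_
  rw [abs_mul, abs_mul, abs_of_pos (ouDrift_pos α t)]
  gcongr
  exact abs_ouScale_sub_one_le hα ht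

theorem ae_comp_affine {p : ℝ → Prop} (hp : ∀ᵐ w : ℝ, p w) {c : ℝ} (hc : c ≠ 0) (a : ℝ) :
    ∀ᵐ z : ℝ, p (c * z + a) := by
  have h1 : Measure.QuasiMeasurePreserving (fun z : ℝ => c * z) :=
    ⟨by fun_prop, by
      rw [Real.map_volume_mul_left hc]; exact Measure.smul_absolutelyContinuous⟩
  have h2 : Measure.QuasiMeasurePreserving (fun z : ℝ => z + a) :=
    (measurePreserving_add_right volume a).quasiMeasurePreserving
  exact (h2.comp h1).ae hp

/-- By Rademacher `h` is differentiable almost everywhere. The map `z ↦ c z + b x` has slope `c ≠ 0`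
and `μ ≪ volume`, so exceptional points are `μ`-null; the Lipschitz constant dominates the
difference quotients. -/
theorem hasDerivAt_ouSemigroup [IsFiniteMeasure μ] (hac : μ ≪ volume)
    (hid : Integrable (fun x : ℝ => x) μ) (hh : LipschitzWith K h) {t : ℝ} (ht : 0 < t) (x : ℝ) :
    HasDerivAt (ouSemigroup α μ h t) (ouDrift α t * ouSemigroup α μ (deriv h) t x) x := by
  have hb := ouDrift_pos α t
  rw [ouSemigroup, ← integral_const_mul]
  refine (hasDerivAt_integral_of_dominated_loc_of_lip (μ := μ) (s := univ)
    (F := fun x z => h (ouScale α t * z + ouDrift α t * x))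
    (bound := fun _ => K * ouDrift α t) Filter.univ_mem
    (Filter.Eventually.of_forall fun y =>
      (hh.integrable_comp_affine hid _ _).aestronglyMeasurable)
    (hh.integrable_comp_affine hid _ _) ?_ ?_ (integrable_const _) ?_).2
  · have := measurable_deriv h
    exact Measurable.aestronglyMeasurable (by fun_prop)
  · refine ae_of_all _ fun z => LipschitzOnWith.of_dist_le_mul fun y _ y' _ => ?_
    rw [Real.coe_nnabs, abs_of_nonneg (by positivity)]
    refine (hh.dist_le_mul _ _).trans_eq ?_
    rw [dist_add_left, Real.dist_eq, ← mul_sub, abs_mul, abs_of_pos hb, Real.dist_eq, mul_assoc]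
  · filter_upwards [hac.ae_le (ae_comp_affine hh.ae_differentiableAt_real
      (ouScale_pos α ht).ne' (ouDrift α t * x))] with z hz
    have h1 : HasDerivAt (fun y => ouScale α t * z + ouDrift α t * y) (ouDrift α t) x := by
      simpa using ((hasDerivAt_id x).const_mul (ouDrift α t)).const_add (ouScale α t * z)
    exact (hz.hasDerivAt.comp x h1).congr_deriv (mul_comm _ _)

theorem abs_ouSemigroup_le [IsProbabilityMeasure μ] {φ : ℝ → ℝ} {M : ℝ} (hM : ∀ x, |φ x| ≤ M)
    (t x : ℝ) : |ouSemigroup α μ φ t x| ≤ M := by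
  simpa [ouSemigroup] using norm_integral_le_of_norm_le_const (μ := μ)
    (f := fun z => φ (ouScale α t * z + ouDrift α t * x)) (ae_of_all _ fun z => hM (ouScale α t * z + ouDrift α t * x))

theorem IsStandardStable.hasDerivAt_ouSemigroup_of_bounded (hα : 1 < α) (hα₂ : α < 2)
    (hμ : IsStandardStable α μ) {φ : ℝ → ℝ} {M : ℝ} (hφ : Measurable φ) (hM : ∀ x, |φ x| ≤ M)
    {t : ℝ} (ht : 0 < t) (x : ℝ) :
    HasDerivAt (ouSemigroup α μ φ t)
      (-(ouDrift α t / ouScale α t * ∫ z, φ (ouScale α t * z + ouDrift α t * x)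
        * stableDensityDeriv α z)) x := by
  have hc := (ouScale_pos α ht).ne'
  -- Factoring out `c` exhibits `x` as a translation by `(b/c) x`; the chain rule then produces the
  -- factor `b/c`.
  have e : ∀ x z, ouScale α t * z + ouDrift α t * x
      = ouScale α t * (z + ouDrift α t / ouScale α t * x) := fun x z => by field_simp
  have h1 := hasDerivAt_integral_comp_add_mul_stableDensity hα hα₂
    (φ := fun w => φ (ouScale α t * w)) (by fun_prop) (fun _ => hM _)
    (ouDrift α t / ouScale α t * x)
  have h2 : HasDerivAt (fun x => ouDrift α t / ouScale α t * x) (ouDrift α t / ouScale α t) x := by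
    simpa using (hasDerivAt_id x).const_mul (ouDrift α t / ouScale α t)
  have h3 := h1.comp x h2
  have e' : ouSemigroup α μ φ t = (fun y => ∫ z, φ (ouScale α t * (z + y)) * stableDensity α 1 z) ∘
      fun x => ouDrift α t / ouScale α t * x := by
    ext x
    rw [ouSemigroup, hμ.integral_eq hα]
    refine integral_congr_ae (ae_of_all _ fun z => ?_)
    simp only [e]
    exact mul_comm _ _
  rw [e']
  refine h3.congr_deriv ?_
  simp only [e]
  ring

theorem IsStandardStable.hasDerivAt_steinSolution (hα : 1 < α) (hμ : IsStandardStable α μ)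
    (hh : LipschitzWith K h) (x : ℝ) :
    HasDerivAt (steinSolution α μ h)
      (-∫ t in Ioi (0 : ℝ), ouDrift α t * ouSemigroup α μ (deriv h) t x) x := by
  have := hμ.1
  have hid := hμ.integrable_id hα
  have hK : ∀ x, |deriv h x| ≤ K := fun x => norm_deriv_le_of_lipschitz hh
  have e : steinSolution α μ h
      = fun x => -∫ t in Ioi (0 : ℝ), (ouSemigroup α μ h t x - ∫ z, h z ∂μ) := by
    ext x
    rw [steinSolution]
    congr 1
    exact setIntegral_congr_fun measurableSet_Ioi fun t ht => hμ.integral_steinIntegrand hα hh x ht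
  rw [e]
  refine HasDerivAt.fun_neg ?_
  refine (hasDerivAt_integral_of_dominated_loc_of_deriv_le (s := univ)
    (F := fun x t => ouSemigroup α μ h t x - ∫ z, h z ∂μ)
    (F' := fun x t => ouDrift α t * ouSemigroup α μ (deriv h) t x)
    (bound := fun t => ouDrift α t * K) Filter.univ_mem
    (Filter.Eventually.of_forall fun y =>
      (integrableOn_ouSemigroup_sub hα hid hh y).aestronglyMeasurable)
    (integrableOn_ouSemigroup_sub hα hid hh x)
    ((measurable_ouDrift α).mul (stronglyMeasurable_ouSemigroup
      (measurable_deriv h) x).measurable).aestronglyMeasurable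
    (ae_of_all _ fun t y _ => ?_) ((integrableOn_ouDrift hα).mul_const _) ?_).2
  · rw [norm_mul, Real.norm_of_nonneg (ouDrift_pos α t).le]
    exact mul_le_mul_of_nonneg_left (abs_ouSemigroup_le hK t y) (ouDrift_pos α t).le
  · filter_upwards [ae_restrict_mem measurableSet_Ioi] with t ht y _
    exact (hasDerivAt_ouSemigroup (hμ.absolutelyContinuous hα) hid hh ht y).sub_const _

theorem abs_integral_ouDrift_mul_ouSemigroup_le [IsProbabilityMeasure μ] (hα : 1 < α)
    {φ : ℝ → ℝ} {M : ℝ} (hM : ∀ x, |φ x| ≤ M) (x : ℝ) :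
    |∫ t in Ioi (0 : ℝ), ouDrift α t * ouSemigroup α μ φ t x| ≤ α * M := by
  have h := norm_integral_le_of_norm_le (f := fun t => ouDrift α t * ouSemigroup α μ φ t x)
    ((integrableOn_ouDrift hα).mul_const M) (ae_of_all _ fun t => by
      rw [norm_mul, Real.norm_of_nonneg (ouDrift_pos α t).le]
      exact mul_le_mul_of_nonneg_left (abs_ouSemigroup_le hM t x) (ouDrift_pos α t).le)
  rwa [integral_mul_const, integral_ouDrift hα] at h

theorem abs_integral_mul_stableDensityDeriv_le (hα : 1 < α) (hα₂ : α < 2) {φ : ℝ → ℝ} {M : ℝ}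
    (hM : ∀ x, |φ x| ≤ M) :
    |∫ z, φ z * stableDensityDeriv α z| ≤ 4 / Real.pi * Real.sqrt ((2 * α + 1) / α) * M := by
  have hM0 : 0 ≤ M := (abs_nonneg _).trans (hM 0)
  have h := norm_integral_le_of_norm_le (f := fun z => φ z * stableDensityDeriv α z)
    ((integrable_stableDensityDeriv hα hα₂).norm.mul_const M) (ae_of_all _ fun z => by
      rw [norm_mul, mul_comm]
      exact mul_le_mul_of_nonneg_left (hM z) (norm_nonneg _))
  rw [integral_mul_const] at h
  exact h.trans (mul_le_mul_of_nonneg_right (integral_abs_stableDensityDeriv_le hα hα₂) hM0)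

/-- The majorant `b²/c` has a singularity of order `t ^ (-1/α)` at `0`, integrable because `1 < α`.
The same majorant, integrated, gives the estimate. -/
theorem IsStandardStable.exists_hasDerivAt_integral_ouSemigroup (hα : 1 < α) (hα₂ : α < 2)
    (hμ : IsStandardStable α μ) {φ : ℝ → ℝ} {M : ℝ} (hφ : Measurable φ) (hM : ∀ x, |φ x| ≤ M)
    (x : ℝ) :
    ∃ d, HasDerivAt (fun x => ∫ t in Ioi (0 : ℝ), ouDrift α t * ouSemigroup α μ φ t x) d x ∧
      |d| ≤ 4 / Real.pi * Real.sqrt ((2 * α + 1) / α) *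
        ProbabilityTheory.beta ((α - 1) / α) (2 / α) * M := by
  have := hμ.1
  set L := 4 / Real.pi * Real.sqrt ((2 * α + 1) / α) with hL
  let F' : ℝ → ℝ → ℝ := fun x t => ouDrift α t * -(ouDrift α t / ouScale α t *
    ∫ z, φ (ouScale α t * z + ouDrift α t * x) * stableDensityDeriv α z)
  have hmeas : ∀ y, Measurable fun t => ouDrift α t * ouSemigroup α μ φ t y := fun y =>
    (measurable_ouDrift α).mul (stronglyMeasurable_ouSemigroup hφ y).measurable
  have hF'm : Measurable (F' x) := by
    have h1 : Measurable fun p : ℝ × ℝ =>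
        φ (ouScale α p.1 * p.2 + ouDrift α p.1 * x) * stableDensityDeriv α p.2 := by
      have := measurable_stableDensityDeriv α
      fun_prop
    have h2 := (h1.stronglyMeasurable.integral_prod_right' (ν := volume)).measurable
    exact (measurable_ouDrift α).mul
      (((measurable_ouDrift α).div (measurable_ouScale α)).mul h2).neg
  have hbound : ∀ t ∈ Ioi (0 : ℝ), ∀ y, ‖F' y t‖
      ≤ ouDrift α t * (ouDrift α t / ouScale α t) * (L * M) := fun t ht y => by
    have hb := ouDrift_pos α t
    have hc := ouScale_pos α ht
    rw [norm_mul, norm_neg, norm_mul, Real.norm_of_nonneg hb.le,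
      Real.norm_of_nonneg (div_pos hb hc).le, mul_assoc]
    gcongr
    exact abs_integral_mul_stableDensityDeriv_le hα hα₂ fun z => hM _
  have hi := (integrableOn_ouDrift_mul_div hα).mul_const (L * M)
  refine ⟨∫ t in Ioi (0 : ℝ), F' x t,
    (hasDerivAt_integral_of_dominated_loc_of_deriv_le (s := univ)
      (F := fun x t => ouDrift α t * ouSemigroup α μ φ t x) (F' := F') Filter.univ_mem
      (Filter.Eventually.of_forall fun y => (hmeas y).aestronglyMeasurable)
      (((integrableOn_ouDrift hα).mul_const M).mono' (hmeas x).aestronglyMeasurable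
        (ae_of_all _ fun t => ?_)) hF'm.aestronglyMeasurable
      (by
        filter_upwards [ae_restrict_mem measurableSet_Ioi] with t ht y _ using hbound t ht y)
      hi ?_).2, ?_⟩
  · rw [norm_mul, Real.norm_of_nonneg (ouDrift_pos α t).le]
    exact mul_le_mul_of_nonneg_left (abs_ouSemigroup_le hM t x) (ouDrift_pos α t).le
  · filter_upwards [ae_restrict_mem measurableSet_Ioi] with t ht y _
    exact (hμ.hasDerivAt_ouSemigroup_of_bounded hα hα₂ hφ hM ht y).const_mul _
  · refine (norm_integral_le_of_norm_le (f := F' x) hi ?_).trans_eq ?_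
    · filter_upwards [ae_restrict_mem measurableSet_Ioi] with t ht using hbound t ht x
    · rw [integral_mul_const, integral_ouDrift_mul_div hα]
      ring

end Semigroup

/-! ### Passage to uniform norms and conclusion. -/

theorem uniformNorm_deriv_lt_top {h : ℝ → ℝ} {K : ℝ≥0} (hh : LipschitzWith K h) :
    uniformNorm (deriv h) < ∞ := by
  refine (iSup_le fun x => ?_ : uniformNorm (deriv h) ≤ K).trans_lt ENNReal.coe_lt_top
  rw [enorm_le_coe]
  exact norm_deriv_le_of_lipschitz hh

theorem abs_le_toReal_uniformNorm {g : ℝ → ℝ} (hg : uniformNorm g < ∞) (x : ℝ) :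
    |g x| ≤ (uniformNorm g).toReal := by
  rw [← Real.norm_eq_abs, ← toReal_enorm]
  exact ENNReal.toReal_mono hg.ne (le_iSup (fun x => ‖g x‖ₑ) x)

theorem uniformNorm_le_of_abs_le {g k : ℝ → ℝ} {C : ℝ} (hC : 0 ≤ C) (hk : uniformNorm k < ∞)
    (hg : ∀ x, |g x| ≤ C * (uniformNorm k).toReal) :
    uniformNorm g ≤ ENNReal.ofReal C * uniformNorm k := by
  refine iSup_le fun x => ?_
  rw [← ENNReal.ofReal_toReal hk.ne, ← ENNReal.ofReal_mul hC, Real.enorm_eq_ofReal_abs]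
  exact ENNReal.ofReal_le_ofReal (hg x)

theorem proposition4p3 (α : ℝ) (hα₁ : 1 < α) (hα₂ : α < 2)
    (μ : Measure ℝ) (hμ : IsStandardStable α μ)
    (h : ℝ → ℝ) (K : ℝ≥0) (hh : LipschitzWith K h) :
    -- the function `f` is well defined and twice differentiable
    Integrable h μ ∧
    (∀ x t : ℝ, 0 < t → Integrable (steinIntegrand α μ h x t)) ∧
    (∀ x : ℝ, IntegrableOn (fun t => ∫ y : ℝ, steinIntegrand α μ h x t y) (Ioi 0)) ∧
    Differentiable ℝ (steinSolution α μ h) ∧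
    Differentiable ℝ (deriv (steinSolution α μ h)) ∧
    -- the two estimates
    uniformNorm (deriv (steinSolution α μ h)) ≤ ENNReal.ofReal α * uniformNorm (deriv h) ∧
    uniformNorm (deriv (deriv (steinSolution α μ h))) ≤
      ENNReal.ofReal (4 / Real.pi * Real.sqrt ((2 * α + 1) / α) *
        ProbabilityTheory.beta ((α - 1) / α) (2 / α)) * uniformNorm (deriv h) := by
  have := hμ.1
  have hid := hμ.integrable_id hα₁
  have hfin := uniformNorm_deriv_lt_top hh
  -- Both estimates use the supremum of `|h'|` as their bound; `K` serves only for finiteness,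
  -- integrability and domination.
  have hM := abs_le_toReal_uniformNorm hfin
  have hd := hμ.hasDerivAt_steinSolution hα₁ hh
  have hderiv : deriv (steinSolution α μ h)
      = fun x => -∫ t in Ioi (0 : ℝ), ouDrift α t * ouSemigroup α μ (deriv h) t x :=
    funext fun x => (hd x).deriv
  have hd2 := hμ.exists_hasDerivAt_integral_ouSemigroup hα₁ hα₂ (measurable_deriv h) hM
  refine ⟨hh.integrable_of_integrable_id hid,
    fun x t ht => hμ.integrable_steinIntegrand hα₁ hh x ht, fun x => ?_,
    fun x => (hd x).differentiableAt, fun x => ?_, ?_, ?_⟩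
  · exact (integrableOn_ouSemigroup_sub hα₁ hid hh x).congr_fun
      (fun t ht => (hμ.integral_steinIntegrand hα₁ hh x ht).symm) measurableSet_Ioi
  · obtain ⟨d, hd, -⟩ := hd2 x
    rw [hderiv]
    exact hd.fun_neg.differentiableAt
  · refine uniformNorm_le_of_abs_le (by linarith) hfin fun x => ?_
    rw [hderiv, abs_neg]
    exact abs_integral_ouDrift_mul_ouSemigroup_le hα₁ hM x
  · refine uniformNorm_le_of_abs_le ?_ hfin fun x => ?_
    · have := ProbabilityTheory.beta_pos (show 0 < (α - 1) / α from
        div_pos (by linarith) (by linarith)) (show 0 < 2 / α by positivity)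
      have := Real.pi_pos
      positivity
    · obtain ⟨d, hd, hle⟩ := hd2 x
      rw [hderiv, hd.fun_neg.deriv, abs_neg]
      exact hle
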